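/- Let $\mathbb K$ be a field, $G$ a group, $n\ge 0$ an integer and $\delta\ge 0$ a real number. A metric space $\mathcal H$ is called $\delta$-hyperbolic if it is geodesic and its Gromov products $\langle p,q\rangle_r=\tfrac12(|p-r|+|q-r|-|p-q|)$ satisfy $\langle p,s\rangle_r\ge\min(\langle p,q\rangle_r,\langle q,s\rangle_r)-\delta$ for all $p,q,r,s\in\mathcal H$. Assume that $G$ acts by isometries on a non-empty $\delta$-hyperbolic space $\mathcal H$ with $$\inf_{g\in G\setminus\{1\},\ p\in\mathcal H}|g\cdot p-p|>(2n+11)^2\delta$$ (the infimum is $+\infty$ if $G$ is trivial). Then: 1. every left ideal of the group algebra $\mathbb K[G]$ that is generated by $n$ elements is a free $\mathbb K[G]$-module; 2. $\mathrm{GE}_n(\mathbb K[G])=\mathrm{GL}_n(\mathbb K[G])$, where $\mathrm{GE}_n(R)$ denotes the subgroup of $\mathrm{GL}_n(R)$ generated by the elementary matrices (those that differ from the identity in at most one entry, which is off the diagonal) and the invertible diagonal matrices. -/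

import Mathlib

noncomputable section

namespace HypGroup

/-- A metric space is geodesic if any two points are joined by a segment parametrized by
arc length. -/
def IsGeodesic (X : Type*) [MetricSpace X] : Prop :=
  ∀ x y : X, ∃ γ : ℝ → X, γ 0 = x ∧ γ (dist x y) = y ∧
    ∀ s ∈ Set.Icc (0 : ℝ) (dist x y), ∀ t ∈ Set.Icc (0 : ℝ) (dist x y),
      dist (γ s) (γ t) = |s - t|

/-- The Gromov product of `p` and `q` with respect to the base point `r`. -/
def gromovProduct {X : Type*} [MetricSpace X] (r p q : X) : ℝ :=
  (dist p r + dist q r - dist p q) / 2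

/-- A `δ`-hyperbolic space: a geodesic metric space whose Gromov products satisfy the
`δ`-ultrametric inequality for every base point. -/
structure IsHyperbolicSpace (X : Type*) [MetricSpace X] (δ : ℝ) : Prop where
  geodesic : IsGeodesic X
  gromov : ∀ r p q s : X,
    min (gromovProduct r p q) (gromovProduct r q s) - δ ≤ gromovProduct r p s

/-- The minimal displacement of an action: the infimum of the distances from `p` to `g • p` over
all points `p` and all non-trivial `g` (it is `∞` for the trivial group). -/
def minDisplacement (G X : Type*) [Group G] [MetricSpace X] [MulAction G X] : ENNReal :=
  ⨅ (g : G) (_ : g ≠ 1) (p : X), edist (g • p) p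

/-- The subgroup `GE n R` of `GL n R` generated by the elementary matrices
(identity plus `c` at an off-diagonal position) and the invertible diagonal matrices. -/
def GE (n : ℕ) (R : Type*) [Ring R] : Subgroup (Matrix.GeneralLinearGroup (Fin n) R) :=
  Subgroup.closure
    {A | (∃ (i j : Fin n) (c : R), i ≠ j ∧
            (A : Matrix (Fin n) (Fin n) R) = 1 + Matrix.single i j c) ∨
         (∃ d : Fin n → R, (A : Matrix (Fin n) (Fin n) R) = Matrix.diagonal d)}

end HypGroup

end

noncomputable section

namespace HypGroup

open Relation

/-! ### Gromov products and the four-point inequality. -/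

section Hyperbolic

variable {X : Type*} [MetricSpace X] {δ : ℝ}

/-! A dependency `∑ a_j ξ_j = 0` allows a Euclidean step. Each translate of `supp ξ_j` by an element
of `supp a_j` moves the base point into a set near a ball; large displacement keeps the centers of
equal index apart. Start at a point almost as far from the base point as possible and collect the
translates chained to it through points at distance at least `θ`. Hyperbolicity makes this component
thin: for suitable `θ`, a member of largest radius is the only one of its index `i`, and the points
closer than `θ` have smaller diameter than that member (`exists_subfamily`). At far points the
coefficients cancel within the component, so its partial sum, normalised, is `ξ_i + ∑_{j ≠ i} b_j
ξ_j` with support diameter smaller by `δ`, or zero (`exists_suppDiam_add_le`).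

Iteration yields a vector whose non-zero entries are left independent (`exists_nonzeroIndep`); this
gives freeness. For an invertible matrix, a reduced column is moreover unimodular, and the
augmentation to `K` shows that its only non-zero entry is a unit (`NonzeroIndep.exists_unit`).
Columns are thus cleared one at a time (`mem_GE_of_hasStdCol`). -/

theorem gromovProduct_self (r p : X) : gromovProduct r p p = dist p r := by
  simp [gromovProduct]

theorem IsHyperbolicSpace.nonneg [Nonempty X] (hX : IsHyperbolicSpace X δ) : 0 ≤ δ := by
  obtain ⟨p⟩ := ‹Nonempty X›
  simpa using hX.gromov p p p p

theorem IsHyperbolicSpace.mono {δ' : ℝ} (hX : IsHyperbolicSpace X δ) (h : δ ≤ δ') :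
    IsHyperbolicSpace X δ' :=
  ⟨hX.geodesic, fun r p q s => by linarith [hX.gromov r p q s]⟩

theorem IsHyperbolicSpace.four_point (hX : IsHyperbolicSpace X δ) (a b c d : X) :
    dist a c + dist b d ≤ dist a b + dist c d + 2 * δ ∨
      dist a c + dist b d ≤ dist b c + dist a d + 2 * δ := by
  have h := hX.gromov d a b c
  unfold gromovProduct at h
  rcases min_choice ((dist a d + dist b d - dist a b) / 2)
    ((dist b d + dist c d - dist b c) / 2) with h' | h' <;> rw [h'] at h
  · left; linarith
  · right; linarith

theorem IsHyperbolicSpace.gromov_three (hX : IsHyperbolicSpace X δ) (hδ : 0 ≤ δ) {m : ℝ}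
    {r a b c d : X} (hab : m ≤ gromovProduct r a b) (hbc : m ≤ gromovProduct r b c)
    (hcd : m ≤ gromovProduct r c d) : m - 2 * δ ≤ gromovProduct r a d := by
  have h1 := (sub_le_sub_right (le_min hab hbc) δ).trans (hX.gromov r a b c)
  have h2 := (sub_le_sub_right (le_min h1 (by linarith)) δ).trans (hX.gromov r a c d)
  linarith

theorem IsGeodesic.exists_midpoint (hX : IsGeodesic X) (x y : X) :
    ∃ m, dist m x = dist x y / 2 ∧ dist m y = dist x y / 2 := by
  obtain ⟨γ, h0, h1, h⟩ := hX x y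
  have hd : 0 ≤ dist x y := dist_nonneg
  refine ⟨γ (dist x y / 2), ?_, ?_⟩
  · have := h (dist x y / 2) ⟨by linarith, by linarith⟩ 0 ⟨le_rfl, hd⟩
    rw [h0] at this
    rw [this, sub_zero, abs_of_nonneg (by linarith)]
  · have := h (dist x y / 2) ⟨by linarith, by linarith⟩ (dist x y) ⟨hd, le_rfl⟩
    rw [h1] at this
    rw [this, abs_of_nonpos (by linarith)]
    ring

end Hyperbolic

/-! ### Chains of bounded length. -/

/-- `y` and `z` are joined by a chain of exactly `N` steps of the relation `r`. -/
def LinkedIn {α : Type*} (r : α → α → Prop) : ℕ → α → α → Prop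
  | 0 => fun a b => a = b
  | N + 1 => fun a c => ∃ b, LinkedIn r N a b ∧ r b c

namespace LinkedIn

variable {α : Type*} {r s : α → α → Prop}

theorem add {M N : ℕ} {a b c : α} (h : LinkedIn r M a b) (h' : LinkedIn r N b c) :
    LinkedIn r (M + N) a c := by
  induction N generalizing c with
  | zero => cases h'; exact h
  | succ N ih =>
    obtain ⟨d, hd, hdc⟩ := h'
    exact ⟨d, ih hd, hdc⟩

theorem split {M N : ℕ} {a c : α} (h : LinkedIn r (M + N) a c) :
    ∃ b, LinkedIn r M a b ∧ LinkedIn r N b c := by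
  induction N generalizing c with
  | zero => exact ⟨c, h, rfl⟩
  | succ N ih =>
    obtain ⟨d, hd, hdc⟩ := h
    obtain ⟨b, hb, hbd⟩ := ih hd
    exact ⟨b, hb, d, hbd, hdc⟩

theorem mono (hrs : ∀ a b, r a b → s a b) {N : ℕ} {a b : α} (h : LinkedIn r N a b) :
    LinkedIn s N a b := by
  induction N generalizing b with
  | zero => exact h
  | succ N ih =>
    obtain ⟨d, hd, hdc⟩ := h
    exact ⟨d, ih hd, hrs _ _ hdc⟩

theorem one {a b : α} (h : r a b) : LinkedIn r 1 a b := ⟨a, rfl, h⟩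

end LinkedIn

/-- Gromov products along a chain of at most `2 ^ m` links drop by at most `m * δ`. -/
theorem IsHyperbolicSpace.gromovProduct_chain {X P : Type*} [MetricSpace X] {δ : ℝ}
    (hX : IsHyperbolicSpace X δ) (hδ : 0 ≤ δ) {x₀ : X} {φ : P → X} {r : P → P → Prop} {β : ℝ}
    (hr : ∀ a b, r a b → β ≤ gromovProduct x₀ (φ a) (φ b)) (m : ℕ) :
    ∀ N : ℕ, 1 ≤ N → N ≤ 2 ^ m → ∀ a b, LinkedIn r N a b →
      β - m * δ ≤ gromovProduct x₀ (φ a) (φ b) := by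
  induction m with
  | zero =>
    intro N h1 h2 a b h
    obtain rfl : N = 1 := by simp at h2; omega
    obtain ⟨c, rfl, h⟩ := h
    simpa using hr _ _ h
  | succ m ih =>
    intro N h1 h2 a b h
    rcases h1.eq_or_lt with rfl | h1
    · obtain ⟨c, rfl, h⟩ := h
      have : 0 ≤ ((m + 1 : ℕ) : ℝ) * δ := by positivity
      linarith [hr _ _ h]
    · rw [pow_succ] at h2
      -- Halving the chain costs one `δ`, so the loss is logarithmic in the length.
      obtain ⟨K, L, rfl, hK, hL, hK', hL'⟩ :
          ∃ K L, N = K + L ∧ 1 ≤ K ∧ 1 ≤ L ∧ K ≤ 2 ^ m ∧ L ≤ 2 ^ m :=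
        ⟨N / 2, N - N / 2, by omega, by omega, by omega, by omega, by omega⟩
      obtain ⟨c, hc, hc'⟩ := h.split
      have := hX.gromov x₀ (φ a) (φ c) (φ b)
      have := le_min (ih K hK hK' a c hc) (ih L hL hL' c b hc')
      push_cast
      linarith

/-! ### Families of near-balls and their chains. -/

section BallSystem

/-- A finite family of point sets in a hyperbolic space. The set `S t` is contained in a ball
about `c t` whose radius depends only on the index of `t`, members with the same index have distant
centers, and `M` bounds the distances to the base point `x₀`. -/
structure IsBallSystem {X P τ ι : Type*} [MetricSpace X] [Fintype ι] (δ : ℝ) (x₀ : X) (φ : P → X)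
    (ix : τ → ι) (c : τ → X) (S : τ → Set P) (rad : ι → ℝ) (M : ℝ) (T : Finset τ) : Prop where
  dist_center : ∀ t ∈ T, ∀ y ∈ S t, dist (φ y) (c t) ≤ rad (ix t) + 2 * δ
  dist_le : ∀ t ∈ T, ∀ y ∈ S t, ∀ z ∈ S t, dist (φ y) (φ z) ≤ 2 * rad (ix t)
  height_le : ∀ t ∈ T, dist (c t) x₀ + rad (ix t) ≤ M
  eq_of_dist : ∀ t ∈ T, ∀ t' ∈ T, ix t = ix t' →
    dist (c t) (c t') ≤ (2 * (Fintype.card ι : ℝ) + 11) ^ 2 * δ → t = t'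

/-- Two points at distance at least `θ` from `x₀` are linked if they lie in a common member of the
family with index in `J`. -/
def Link {X P τ ι : Type*} [MetricSpace X] (x₀ : X) (φ : P → X)
    (ix : τ → ι) (S : τ → Set P) (T : Finset τ) (θ : ℝ) (J : Finset ι) (y z : P) : Prop :=
  θ ≤ dist (φ y) x₀ ∧ θ ≤ dist (φ z) x₀ ∧ ∃ t ∈ T, ix t ∈ J ∧ y ∈ S t ∧ z ∈ S t

variable {X P τ ι : Type*} [MetricSpace X] {δ : ℝ} {x₀ : X} {φ : P → X}
  {ix : τ → ι} {c : τ → X} {S : τ → Set P} {rad : ι → ℝ} {M : ℝ} {T : Finset τ}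

theorem Link.symm {θ : ℝ} {J : Finset ι} {y z : P} (h : Link x₀ φ ix S T θ J y z) :
    Link x₀ φ ix S T θ J z y := by
  obtain ⟨h1, h2, t, h3, h4, h5, h6⟩ := h
  exact ⟨h2, h1, t, h3, h4, h6, h5⟩

theorem Link.mono {θ θ' : ℝ} {J J' : Finset ι} (hθ : θ' ≤ θ) (hJ : J ⊆ J') {y z : P}
    (h : Link x₀ φ ix S T θ J y z) : Link x₀ φ ix S T θ' J' y z := by
  obtain ⟨h1, h2, t, h3, h4, h5, h6⟩ := h
  exact ⟨hθ.trans h1, hθ.trans h2, t, h3, hJ h4, h5, h6⟩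

namespace IsBallSystem

variable [Fintype ι]

theorem subset (hT : IsBallSystem δ x₀ φ ix c S rad M T) {T' : Finset τ} (h : T' ⊆ T) :
    IsBallSystem δ x₀ φ ix c S rad M T' :=
  ⟨fun t ht => hT.dist_center t (h ht), fun t ht => hT.dist_le t (h ht),
    fun t ht => hT.height_le t (h ht), fun t ht t' ht' => hT.eq_of_dist t (h ht) t' (h ht')⟩

/-- Members with the same index are equal if they contain far points with a large Gromov product. -/
theorem eq_of_gromovProduct (hT : IsBallSystem δ x₀ φ ix c S rad M T) (hX : IsHyperbolicSpace X δ)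
    (hδ : 0 ≤ δ) {θ : ℝ}
    (hθ : M - θ ≤ 2 * δ + Fintype.card ι * (2 * Fintype.card ι + 11) * δ)
    {t t' : τ} (ht : t ∈ T) (ht' : t' ∈ T) (hix : ix t = ix t') {y y' : P} (hy : y ∈ S t)
    (hy' : y' ∈ S t') (hθy : θ ≤ dist (φ y) x₀) (hθy' : θ ≤ dist (φ y') x₀)
    (h : θ - rad (ix t) - (3 * Fintype.card ι + 11) * δ ≤ gromovProduct x₀ (φ y) (φ y')) :
    t = t' := by
  apply hT.eq_of_dist t ht t' ht' hix
  have h1 := hT.dist_center t ht y hy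
  have h2 := hT.dist_center t' ht' y' hy'
  have h3 := hT.height_le t ht
  have h4 := hT.height_le t' ht'
  rw [← hix] at h2 h4
  set n : ℝ := (Fintype.card ι : ℝ) with hn
  have hn0 : 0 ≤ n * δ := by positivity
  have hn1 : 0 ≤ n * n * δ := by positivity
  by_contra! hlt
  -- `m` is chosen so that `key` contradicts `hlt`. The middle link needs `2n² + 14n + 15 ≤ (2n +
  -- 11)² / 2`.
  have key := hX.gromov_three hδ (r := x₀) (a := c t) (b := φ y) (c := φ y') (d := c t')
    (m := (dist (c t) x₀ + dist (c t') x₀ - (2 * n + 11) ^ 2 * δ) / 2 + 2 * δ)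
    (by
      simp only [gromovProduct]
      rw [dist_comm (c t) (φ y)]
      nlinarith)
    (by nlinarith)
    (by
      simp only [gromovProduct]
      nlinarith)
  simp only [gromovProduct] at key
  linarith

/-- Far points in the same connected component have chains of bounded length between them. -/
theorem exists_linkedIn [DecidableEq ι] (hT : IsBallSystem δ x₀ φ ix c S rad M T)
    (hX : IsHyperbolicSpace X δ) (hδ : 0 ≤ δ) {θ : ℝ}
    (hθ : M - θ ≤ 2 * δ + Fintype.card ι * (2 * Fintype.card ι + 11) * δ) (J : Finset ι) :
    ∀ y z, ReflTransGen (Link x₀ φ ix S T θ J) y z →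
      ∃ N < 2 ^ J.card, LinkedIn (Link x₀ φ ix S T θ J) N y z := by
  -- Indices are added by increasing radius, so links in `J` have radius at most that of the new
  -- index `k`.
  induction J using Finset.induction_on_max_value rad with
  | empty =>
    intro y z h
    refine ⟨0, by simp, ?_⟩
    induction h with
    | refl => rfl
    | tail _ h _ =>
      obtain ⟨_, _, t, _, ht, _⟩ := h
      simp at ht
  | insert k J hk hmax ih =>
    intro y z h
    -- One step through index `k` suffices: two members of that index joined by a `J`-chain
    -- coincide. Hence the length is at most `(2^|J| - 1) + 1 + (2^|J| - 1)`.
    have dichotomy : ReflTransGen (Link x₀ φ ix S T θ J) y z ∨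
        ∃ u v, ReflTransGen (Link x₀ φ ix S T θ J) y u ∧
          ReflTransGen (Link x₀ φ ix S T θ J) v z ∧ θ ≤ dist (φ u) x₀ ∧ θ ≤ dist (φ v) x₀ ∧
          ∃ t ∈ T, ix t = k ∧ u ∈ S t ∧ v ∈ S t := by
      induction h with
      | refl => exact Or.inl .refl
      | @tail z w _ hzw IH =>
        obtain ⟨hz, hw, t, ht, htJ, hzt, hwt⟩ := hzw
        rcases Finset.mem_insert.1 htJ with htk | htJ
        · right
          rcases IH with IH | ⟨u, v, hyu, hvz, hu, hv, t', ht', htk', hut', hvt'⟩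
          · exact ⟨z, w, IH, .refl, hz, hw, t, ht, htk, hzt, hwt⟩
          · have : t' = t := by
              refine hT.eq_of_gromovProduct hX hδ hθ ht' ht (htk'.trans htk.symm) hvt' hzt hv hz ?_
              obtain ⟨N, hN, hNvz⟩ := ih v z hvz
              have hrad : 0 ≤ rad (ix t') := by
                have := hT.dist_le t' ht' v hvt' v hvt'
                rw [dist_self] at this
                linarith
              have hnδ : 0 ≤ (Fintype.card ι : ℝ) * δ := by positivity
              rcases Nat.eq_zero_or_pos N with rfl | hN0
              · obtain rfl : v = z := hNvz
                rw [gromovProduct_self]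
                linarith
              · have hJ : J.card ≤ Fintype.card ι := J.card_le_univ
                have := hX.gromovProduct_chain hδ (x₀ := x₀) (φ := φ) (β := θ - rad k)
                  (r := Link x₀ φ ix S T θ J) ?_ (Fintype.card ι) N hN0
                  (hN.le.trans (Nat.pow_le_pow_right (by norm_num) hJ)) v z hNvz
                · rw [htk']
                  linarith
                · rintro a b ⟨ha, hb, s, hs, hsJ, has, hbs⟩
                  have h1 := hT.dist_le s hs a has b hbs
                  have h2 := hmax _ hsJ
                  simp only [gromovProduct]
                  linarith
            subst this
            exact ⟨u, w, hyu, .refl, hu, hw, t', ht, htk, hut', hwt⟩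
        · rcases IH with IH | ⟨u, v, hyu, hvz, h⟩
          · exact Or.inl (IH.tail ⟨hz, hw, t, ht, htJ, hzt, hwt⟩)
          · exact Or.inr ⟨u, v, hyu, hvz.tail ⟨hz, hw, t, ht, htJ, hzt, hwt⟩, h⟩
    have hmono : ∀ a b, Link x₀ φ ix S T θ J a b → Link x₀ φ ix S T θ (insert k J) a b :=
      fun a b => Link.mono le_rfl (Finset.subset_insert k J)
    rw [Finset.card_insert_of_notMem hk, pow_succ]
    rcases dichotomy with h | ⟨u, v, hyu, hvz, hu, hv, t, ht, htk, hut, hvt⟩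
    · obtain ⟨N, hN, h⟩ := ih y z h
      exact ⟨N, by omega, h.mono hmono⟩
    · obtain ⟨N, hN, h⟩ := ih y u hyu
      obtain ⟨N', hN', h'⟩ := ih v z hvz
      refine ⟨N + 1 + N', by omega, ((h.mono hmono).add (.one ?_)).add (h'.mono hmono)⟩
      exact ⟨hu, hv, t, ht, by simp [htk], hut, hvt⟩

/-- A lower bound for Gromov products of linked points gives one for connected points. -/
theorem gromovProduct_of_reflTransGen (hT : IsBallSystem δ x₀ φ ix c S rad M T)
    (hX : IsHyperbolicSpace X δ) (hδ : 0 ≤ δ) {θ : ℝ}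
    (hθ : M - θ ≤ 2 * δ + Fintype.card ι * (2 * Fintype.card ι + 11) * δ) {β : ℝ}
    (hβ : ∀ t ∈ T, ∀ y ∈ S t, ∀ z ∈ S t, θ ≤ dist (φ y) x₀ → θ ≤ dist (φ z) x₀ →
      β ≤ gromovProduct x₀ (φ y) (φ z)) {t : τ} (ht : t ∈ T) {y z : P} (hyt : y ∈ S t)
    (hy : θ ≤ dist (φ y) x₀)
    (h : ReflTransGen (Link x₀ φ ix S T θ Finset.univ) y z) :
    β - Fintype.card ι * δ ≤ gromovProduct x₀ (φ y) (φ z) := by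
  classical
  obtain ⟨N, hN, hyz⟩ := hT.exists_linkedIn hX hδ hθ Finset.univ y z h
  rcases Nat.eq_zero_or_pos N with rfl | hN0
  · obtain rfl : y = z := hyz
    have : 0 ≤ (Fintype.card ι : ℝ) * δ := by positivity
    linarith [hβ t ht y hyt y hyt hy hy]
  · refine hX.gromovProduct_chain hδ (r := Link x₀ φ ix S T θ Finset.univ) ?_ _ N hN0 hN.le y z hyz
    rintro a b ⟨ha, hb, t, ht, -, hat, hbt⟩
    exact hβ t ht a hat b hbt ha hb

end IsBallSystem

end BallSystem

/-! ### The component of a far point and the choice of level. -/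

section Component

variable {X P τ ι : Type*} [MetricSpace X] [Fintype ι] {δ : ℝ} {x₀ : X} {φ : P → X}
  {ix : τ → ι} {c : τ → X} {S : τ → Set P} {rad : ι → ℝ} {M : ℝ} {T : Finset τ}

open Classical in
/-- The members of the family that contain a point at distance at least `θ` from `x₀` which is
connected to `y₀` through such points. -/
def component (x₀ : X) (φ : P → X) (ix : τ → ι) (S : τ → Set P) (T : Finset τ) (y₀ : P) (θ : ℝ) :
    Finset τ :=
  {t ∈ T | ∃ y ∈ S t, θ ≤ dist (φ y) x₀ ∧ ReflTransGen (Link x₀ φ ix S T θ Finset.univ) y₀ y}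

theorem mem_component {y₀ : P} {θ : ℝ} {t : τ} : t ∈ component x₀ φ ix S T y₀ θ ↔ t ∈ T ∧
    ∃ y ∈ S t, θ ≤ dist (φ y) x₀ ∧ ReflTransGen (Link x₀ φ ix S T θ Finset.univ) y₀ y := by
  simp [component]

theorem component_subset (y₀ : P) (θ : ℝ) : component x₀ φ ix S T y₀ θ ⊆ T :=
  fun _ ht => (mem_component.1 ht).1

theorem component_anti {y₀ : P} {θ θ' : ℝ} (h : θ' ≤ θ) :
    component x₀ φ ix S T y₀ θ ⊆ component x₀ φ ix S T y₀ θ' := by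
  intro t ht
  obtain ⟨htT, y, hy, hθy, hr⟩ := mem_component.1 ht
  exact mem_component.2 ⟨htT, y, hy, h.trans hθy, ReflTransGen.mono (fun a b => Link.mono h subset_rfl) _ _ hr⟩

theorem reflTransGen_of_mem_component {y₀ : P} {θ : ℝ} {t : τ}
    (ht : t ∈ component x₀ φ ix S T y₀ θ) {y : P} (hy : y ∈ S t) (hθ : θ ≤ dist (φ y) x₀) :
    ReflTransGen (Link x₀ φ ix S T θ Finset.univ) y₀ y := by
  obtain ⟨htT, z, hz, hθz, hr⟩ := mem_component.1 ht
  exact hr.tail ⟨hθz, hθ, t, htT, Finset.mem_univ _, hz, hy⟩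

theorem mem_component_of_mem {y₀ : P} {θ : ℝ} {t t' : τ}
    (ht : t ∈ component x₀ φ ix S T y₀ θ) {y : P} (hy : y ∈ S t) (hθ : θ ≤ dist (φ y) x₀)
    (ht' : t' ∈ T) (hy' : y ∈ S t') : t' ∈ component x₀ φ ix S T y₀ θ :=
  mem_component.2 ⟨ht', y, hy', hθ, reflTransGen_of_mem_component ht hy hθ⟩

/-- Every link on a path from `y₀` lies in a member of the component, so estimates on the component
alone control the path. -/
theorem reflTransGen_component {y₀ : P} {θ : ℝ} {y : P}
    (h : ReflTransGen (Link x₀ φ ix S T θ Finset.univ) y₀ y) :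
    ReflTransGen (Link x₀ φ ix S (component x₀ φ ix S T y₀ θ) θ Finset.univ) y₀ y := by
  induction h with
  | refl => exact .refl
  | tail h hzw ih =>
    obtain ⟨h1, h2, t, h3, h4, h5, h6⟩ := hzw
    exact ih.tail ⟨h1, h2, t, mem_component.2 ⟨h3, _, h5, h1, h⟩, h4, h5, h6⟩

namespace IsBallSystem

/-- The points are connected through `y₀`. The loss depends only on the number of indices, not on
the size of the family. -/
theorem gromovProduct_of_mem_component (hT : IsBallSystem δ x₀ φ ix c S rad M T)
    (hX : IsHyperbolicSpace X δ) (hδ : 0 ≤ δ) {y₀ : P} {θ : ℝ}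
    (hθ : M - θ ≤ 2 * δ + Fintype.card ι * (2 * Fintype.card ι + 11) * δ) {β : ℝ}
    (hβ : ∀ t ∈ component x₀ φ ix S T y₀ θ, ∀ y ∈ S t, ∀ z ∈ S t,
      θ ≤ dist (φ y) x₀ → θ ≤ dist (φ z) x₀ → β ≤ gromovProduct x₀ (φ y) (φ z))
    {t t' : τ} (ht : t ∈ component x₀ φ ix S T y₀ θ) (ht' : t' ∈ component x₀ φ ix S T y₀ θ)
    {y z : P} (hy : y ∈ S t) (hz : z ∈ S t') (hθy : θ ≤ dist (φ y) x₀) (hθz : θ ≤ dist (φ z) x₀) :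
    β - Fintype.card ι * δ ≤ gromovProduct x₀ (φ y) (φ z) := by
  refine (hT.subset (component_subset y₀ θ)).gromovProduct_of_reflTransGen hX hδ hθ hβ ht hy hθy ?_
  refine .trans ?_ (reflTransGen_component (reflTransGen_of_mem_component ht' hz hθz))
  have : Std.Symm (Link x₀ φ ix S (component x₀ φ ix S T y₀ θ) θ Finset.univ) :=
    ⟨fun _ _ => Link.symm⟩
  exact symm (reflTransGen_component (reflTransGen_of_mem_component ht hy hθy))

/-- If all radii in a component are at most `ρ`, then members of the component with the same index
and with radius close to `ρ` are equal. -/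
theorem eq_of_mem_component (hT : IsBallSystem δ x₀ φ ix c S rad M T)
    (hX : IsHyperbolicSpace X δ) (hδ : 0 ≤ δ) {y₀ : P} {θ : ℝ}
    (hθ : M - θ ≤ 2 * δ + Fintype.card ι * (2 * Fintype.card ι + 11) * δ) {ρ : ℝ}
    (hρ : ∀ t ∈ component x₀ φ ix S T y₀ θ, rad (ix t) ≤ ρ)
    {t t' : τ} (ht : t ∈ component x₀ φ ix S T y₀ θ) (ht' : t' ∈ component x₀ φ ix S T y₀ θ)
    (hix : ix t = ix t') (hrad : ρ ≤ rad (ix t) + (2 * Fintype.card ι + 11) * δ) : t = t' := by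
  obtain ⟨htT, y, hy, hθy, -⟩ := mem_component.1 ht
  obtain ⟨htT', z, hz, hθz, -⟩ := mem_component.1 ht'
  refine hT.eq_of_gromovProduct hX hδ hθ htT htT' hix hy hz hθy hθz ?_
  have := hT.gromovProduct_of_mem_component hX hδ hθ (β := θ - ρ) ?_ ht ht' hy hz
    hθy hθz
  · linarith
  · intro s hs a ha b hb hθa hθb
    have h1 := hT.dist_le s (component_subset _ _ hs) a ha b hb
    have h2 := hρ s hs
    simp only [gromovProduct]
    linarith

/-- At one of the first few levels, all centers in the component are far from `x₀`. -/
theorem exists_good_level (hT : IsBallSystem δ x₀ φ ix c S rad M T)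
    (hX : IsHyperbolicSpace X δ) (hδ : 0 ≤ δ) {t₁ : τ} (ht₁ : t₁ ∈ T) {y₀ : P} (hy₀ : y₀ ∈ S t₁)
    (htop : M - 2 * δ ≤ dist (φ y₀) x₀) :
    ∃ θ, M - θ ≤ 2 * δ + Fintype.card ι * (2 * Fintype.card ι + 11) * δ ∧ θ ≤ M - 2 * δ ∧
      ∀ t ∈ component x₀ φ ix S T y₀ θ, ∃ s ∈ component x₀ φ ix S T y₀ θ,
        θ - rad (ix s) + (2 * Fintype.card ι + 9) * δ ≤ dist (c t) x₀ := by
  classical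
  -- If every level fails, each lowering by `Δ` brings a new index into the component, which gives
  -- `n + 1` indices at level `n`.
  by_contra! hbad
  set n := Fintype.card ι with hn
  set Δ : ℝ := (2 * n + 11) * δ with hΔ
  have hΔ0 : 0 ≤ Δ := by positivity
  set lev : ℕ → ℝ := fun k => M - 2 * δ - k * Δ with hlev
  have hlev_le (k : ℕ) : lev k ≤ M - 2 * δ := by
    have : 0 ≤ k * Δ := by positivity
    simp only [hlev]; linarith
  have hlev_ge (k : ℕ) (hk : k ≤ n) : M - lev k ≤ 2 * δ + n * (2 * n + 11) * δ := by
    have : k * Δ ≤ n * Δ := by gcongr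
    simp only [hlev]
    rw [mul_assoc, ← hΔ]
    linarith
  have hlev_succ (k : ℕ) : lev (k + 1) = lev k - Δ := by
    simp only [hlev]; push_cast; ring
  have hcard (k : ℕ) (hk : k ≤ n) :
      k + 1 ≤ ((component x₀ φ ix S T y₀ (lev k)).image ix).card := by
    induction k with
    | zero =>
      rw [zero_add, Nat.one_le_iff_ne_zero, Finset.card_ne_zero]
      exact ⟨ix t₁, Finset.mem_image_of_mem _
        (mem_component.2 ⟨ht₁, y₀, hy₀, (hlev_le 0).trans htop, .refl⟩)⟩
    | succ k ih =>
      refine Nat.succ_le_of_lt ((ih (by omega)).trans_lt ?_)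
      apply Finset.card_lt_card
      have hle : lev (k + 1) ≤ lev k := by rw [hlev_succ]; linarith
      rw [Finset.ssubset_iff_of_subset (Finset.image_subset_image (component_anti hle))]
      obtain ⟨t, ht, hbt⟩ := hbad _ (hlev_ge (k + 1) hk) (hlev_le (k + 1))
      refine ⟨ix t, Finset.mem_image_of_mem _ ht, fun hmem => ?_⟩
      obtain ⟨t', ht', hix⟩ := Finset.mem_image.1 hmem
      -- The center of `t` is close to `x₀`. As `t` still reaches height `lev (k + 1)`, its radius
      -- is within `Δ` of the maximum, so `t` is alone in its index; yet all its points lie below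
      -- `lev k`. Here `2n + 11` is `2n + 9` plus the `2` from `dist_center`.
      obtain ⟨s, hs, hmax⟩ := Finset.exists_max_image (component x₀ φ ix S T y₀ (lev (k + 1)))
        (fun t => rad (ix t)) ⟨t, ht⟩
      have hts := hbt s hs
      obtain ⟨htT, y, hy, hθy, -⟩ := mem_component.1 ht
      have h1 := hT.dist_center t htT y hy
      have h2 := dist_triangle (φ y) (c t) x₀
      have heq : t = t' := hT.eq_of_mem_component hX hδ (hlev_ge (k + 1) hk) hmax ht (component_anti hle ht') hix.symm (by linarith)
      subst heq
      obtain ⟨-, z, hz, hθz, -⟩ := mem_component.1 ht'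
      have h3 := hT.dist_center t htT z hz
      have h4 := dist_triangle (φ z) (c t) x₀
      have h5 := hmax t ht
      rw [hlev_succ] at hts
      linarith
  have h1 := hcard n le_rfl
  have h2 := Finset.card_le_univ ((component x₀ φ ix S T y₀ (lev n)).image ix)
  omega

/-- There is a subfamily such that every point far from `x₀` of a member of the subfamily lies only
in members of the subfamily, while the other points of the members form a set of small diameter. -/
theorem exists_subfamily (hT : IsBallSystem δ x₀ φ ix c S rad M T)
    (hX : IsHyperbolicSpace X δ) (hδ : 0 ≤ δ) {t₁ : τ} (ht₁ : t₁ ∈ T) {y₀ : P} (hy₀ : y₀ ∈ S t₁)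
    (htop : M - 2 * δ ≤ dist (φ y₀) x₀) :
    ∃ T' ⊆ T, ∃ t₀ ∈ T', ∃ θ, (∀ t ∈ T', ix t = ix t₀ → t = t₀) ∧
      (∀ t ∈ T', ∀ y ∈ S t, θ ≤ dist (φ y) x₀ → ∀ t' ∈ T, y ∈ S t' → t' ∈ T') ∧
      ∀ t ∈ T', ∀ t' ∈ T', ∀ y ∈ S t, ∀ z ∈ S t', dist (φ y) x₀ < θ → dist (φ z) x₀ < θ →
        dist (φ y) (φ z) ≤ 2 * rad (ix t₀) - δ := by
  obtain ⟨θ, hθ, hθM, hgood⟩ := hT.exists_good_level hX hδ ht₁ hy₀ htop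
  obtain ⟨t₀, ht₀, hmax⟩ := Finset.exists_max_image (component x₀ φ ix S T y₀ θ)
    (fun t => rad (ix t)) ⟨t₁, mem_component.2 ⟨ht₁, y₀, hy₀, hθM.trans htop, .refl⟩⟩
  have hsub := component_subset (x₀ := x₀) (φ := φ) (ix := ix) (S := S) (T := T) y₀ θ
  set n : ℝ := (Fintype.card ι : ℝ) with hn
  set ρ := rad (ix t₀) with hρ
  have hfar (t) (ht : t ∈ component x₀ φ ix S T y₀ θ) :
      θ - ρ + (2 * n + 9) * δ ≤ dist (c t) x₀ := by
    obtain ⟨s, hs, h⟩ := hgood t ht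
    linarith [hmax s hs]
  have hnδ : 0 ≤ n * δ := by positivity
  refine ⟨_, hsub, t₀, ht₀, θ, ?_, ?_, ?_⟩
  · intro t ht hix
    exact (hT.eq_of_mem_component hX hδ hθ hmax ht₀ ht hix.symm
      (by nlinarith)).symm
  · exact fun t ht y hy hθy t' ht' hy' => mem_component_of_mem ht hy hθy ht' hy'
  · have hpair (t) (ht : t ∈ component x₀ φ ix S T y₀ θ) (y) (hy : y ∈ S t) (z) (hz : z ∈ S t) :
        min (dist (φ y) x₀) (dist (φ z) x₀) + dist (c t) x₀ - rad (ix t) - 4 * δ ≤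
          2 * gromovProduct x₀ (φ y) (φ z) := by
      have h1 := hT.dist_center t (hsub ht) y hy
      have h2 := hT.dist_center t (hsub ht) z hz
      have h3 := min_le_left (dist (φ y) x₀) (dist (φ z) x₀)
      have h4 := min_le_right (dist (φ y) x₀) (dist (φ z) x₀)
      have h5 := hX.four_point (φ y) x₀ (φ z) (c t)
      rw [dist_comm x₀ (c t), dist_comm x₀ (φ z)] at h5
      simp only [gromovProduct]
      rcases h5 with h5 | h5 <;> linarith
    -- The bound equals `θ - ρ + 5δ/2`, exactly what `key` below requires; this fixes the constant
    -- `2n + 9`.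
    have hcomp {t t' : τ} (ht : t ∈ component x₀ φ ix S T y₀ θ)
        (ht' : t' ∈ component x₀ φ ix S T y₀ θ) {y z : P} (hy : y ∈ S t) (hz : z ∈ S t')
        (hθy : θ ≤ dist (φ y) x₀) (hθz : θ ≤ dist (φ z) x₀) :
        θ - ρ + ((2 * n + 9) * δ - 4 * δ) / 2 - n * δ ≤
          gromovProduct x₀ (φ y) (φ z) := by
      refine hT.gromovProduct_of_mem_component hX hδ hθ ?_ ht ht' hy hz hθy hθz
      intro s hs a ha b hb hθa hθb
      have h1 := hpair s hs a ha b hb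
      have h2 := le_min hθa hθb
      linarith [hfar s hs, hmax s hs]
    intro t ht t' ht' s hs r hr hθs hθr
    obtain ⟨htT, y, hy, hθy, -⟩ := mem_component.1 ht
    obtain ⟨htT', z, hz, hθz, -⟩ := mem_component.1 ht'
    by_contra! hlt
    have h1 := hpair t ht s hs y hy
    have h2 := hpair t' ht' z hz r hr
    rw [min_eq_left (hθs.le.trans hθy)] at h1
    rw [min_eq_right (hθr.le.trans hθz)] at h2
    have h3 := hcomp ht ht' hy hz hθy hθz
    have key := hX.gromov_three hδ (r := x₀) (a := φ s) (b := φ y) (c := φ z) (d := φ r)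
      (m := (dist (φ s) x₀ + dist (φ r) x₀ - 2 * ρ + δ) / 2 + 2 * δ)
      (by linarith [hfar t ht, hmax t ht]) (by linarith) (by linarith [hfar t' ht', hmax t' ht'])
    simp only [gromovProduct] at key
    linarith

end IsBallSystem

end Component

/-! ### Shortening supports in the group algebra. -/

section SuppDiam

open MonoidAlgebra

variable {K G X : Type*} [Field K] [Group G] [MetricSpace X] [MulAction G X]

/-- The diameter of the translates of `p` by the support of an element of the group algebra. -/
def suppDiam (p : X) (f : MonoidAlgebra K G) : ℝ :=
  Metric.diam ((fun g : G => g • p) '' (f.coeff.support : Set G))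

theorem suppDiam_nonneg (p : X) (f : MonoidAlgebra K G) : 0 ≤ suppDiam p f := Metric.diam_nonneg

theorem dist_le_suppDiam (p : X) {f : MonoidAlgebra K G} {g h : G} (hg : f.coeff g ≠ 0)
    (hh : f.coeff h ≠ 0) : dist (g • p) (h • p) ≤ suppDiam p f :=
  Metric.dist_le_diam_of_mem ((f.coeff.support.finite_toSet).image _).isBounded
    (Set.mem_image_of_mem _ (by simpa using hg)) (Set.mem_image_of_mem _ (by simpa using hh))

theorem suppDiam_le {p : X} {f : MonoidAlgebra K G} {C : ℝ} (hC : 0 ≤ C)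
    (h : ∀ g h, f.coeff g ≠ 0 → f.coeff h ≠ 0 → dist (g • p) (h • p) ≤ C) : suppDiam p f ≤ C := by
  refine Metric.diam_le_of_forall_dist_le hC ?_
  rintro _ ⟨g, hg, rfl⟩ _ ⟨g', hg', rfl⟩
  exact h g g' (by simpa using hg) (by simpa using hg')

theorem exists_dist_eq_suppDiam (p : X) {f : MonoidAlgebra K G} (hf : f ≠ 0) :
    ∃ g h, f.coeff g ≠ 0 ∧ f.coeff h ≠ 0 ∧ dist (g • p) (h • p) = suppDiam p f := by
  have hne : f.coeff.support.Nonempty := by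
    rw [Finsupp.support_nonempty_iff]
    intro h
    exact hf (MonoidAlgebra.coeff_injective (by simpa using h))
  obtain ⟨⟨g, h⟩, hgh, hmax⟩ := Finset.exists_max_image (f.coeff.support ×ˢ f.coeff.support)
    (fun q => dist (q.1 • p) (q.2 • p)) (hne.product hne)
  simp only [Finset.mem_product, Finsupp.mem_support_iff] at hgh hmax
  refine ⟨g, h, hgh.1, hgh.2, le_antisymm (dist_le_suppDiam p hgh.1 hgh.2) ?_⟩
  exact suppDiam_le dist_nonneg fun a b ha hb => hmax (a, b) ⟨ha, hb⟩

theorem coeff_mul_eq_sum (a x : MonoidAlgebra K G) (y : G) :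
    (a * x).coeff y = ∑ h ∈ a.coeff.support, a.coeff h * x.coeff (h⁻¹ * y) := by
  rw [coeff_mul_apply_left]
  rfl

variable [IsIsometricSMul G X]

/-- Dependent elements of the group algebra of a group acting with large displacement: one of
them can be changed by a combination of the others so that its support gets smaller. -/
theorem exists_suppDiam_add_le {ι : Type*} [Fintype ι] {δ : ℝ}
    (hX : IsHyperbolicSpace X δ) (hδ : 0 ≤ δ)
    (hG : ∀ g : G, g ≠ 1 → ∀ q : X, (2 * (Fintype.card ι : ℝ) + 11) ^ 2 * δ < dist (g • q) q)
    (p : X) {ξ a : ι → MonoidAlgebra K G} (ha : a ≠ 0) (hξa : ∀ j, ξ j = 0 → a j = 0)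
    (h : ∑ j, a j * ξ j = 0) :
    ∃ i, ∃ b : ι → MonoidAlgebra K G, ξ i ≠ 0 ∧ b i = 0 ∧ (∀ j, ξ j = 0 → b j = 0) ∧
      (ξ i + ∑ j, b j * ξ j = 0 ∨ suppDiam p (ξ i + ∑ j, b j * ξ j) ≤ suppDiam p (ξ i) - δ) := by
  classical
  have hdata (j : ι) : ∃ y z : G, ∃ m : X, ξ j ≠ 0 → (ξ j).coeff y ≠ 0 ∧ (ξ j).coeff z ≠ 0 ∧
      dist (y • p) (z • p) = suppDiam p (ξ j) ∧ dist m (y • p) = suppDiam p (ξ j) / 2 ∧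
      dist m (z • p) = suppDiam p (ξ j) / 2 := by
    by_cases hj : ξ j = 0
    · exact ⟨1, 1, p, fun h => absurd hj h⟩
    · obtain ⟨y, z, hy, hz, hyz⟩ := exists_dist_eq_suppDiam p hj
      obtain ⟨m, h1, h2⟩ := hX.geodesic.exists_midpoint (y • p) (z • p)
      rw [hyz] at h1 h2
      exact ⟨y, z, m, fun _ => ⟨hy, hz, hyz, h1, h2⟩⟩
  choose y z m hm using hdata
  -- The member `(j, g)` stands for the translate of `supp ξ_j` by `g`, centered at the translated
  -- midpoint of a diametral pair.
  set T : Finset (Σ _ : ι, G) := Finset.univ.sigma fun j => (a j).coeff.support with hTdef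
  set c : (Σ _ : ι, G) → X := fun t => t.2 • m t.1 with hc
  set S : (Σ _ : ι, G) → Set G := fun t => {w | (ξ t.1).coeff (t.2⁻¹ * w) ≠ 0} with hS
  set rad : ι → ℝ := fun j => suppDiam p (ξ j) / 2 with hrad
  have hTξ {t : Σ _ : ι, G} (ht : t ∈ T) : ξ t.1 ≠ 0 := by
    intro h0
    simp [hTdef, hξa _ h0] at ht
  have hTne : T.Nonempty := by
    obtain ⟨j, hj⟩ := Function.ne_iff.1 ha
    have : (a j).coeff ≠ 0 := fun h0 => hj (MonoidAlgebra.coeff_injective (by simpa using h0))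
    obtain ⟨g, hg⟩ := Finsupp.support_nonempty_iff.2 this
    exact ⟨⟨j, g⟩, by simpa [hTdef] using hg⟩
  obtain ⟨t₁, ht₁, hmax⟩ := Finset.exists_max_image T (fun t => dist (c t) p + rad t.1) hTne
  have hT : IsBallSystem δ p (fun g : G => g • p) Sigma.fst c S rad (dist (c t₁) p + rad t₁.1) T := by
    refine ⟨?_, ?_, hmax, ?_⟩
    · rintro t ht w hw
      obtain ⟨h1, h2, h3, h4, h5⟩ := hm t.1 (hTξ ht)
      have hd : dist (w • p) (c t) = dist ((t.2⁻¹ * w) • p) (m t.1) := by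
        rw [← dist_smul t.2 ((t.2⁻¹ * w) • p), smul_smul, mul_inv_cancel_left]
      have h6 := hX.four_point ((t.2⁻¹ * w) • p) (y t.1 • p) (m t.1) (z t.1 • p)
      have h7 := dist_le_suppDiam p hw h1
      have h8 := dist_le_suppDiam p hw h2
      rw [dist_comm (y t.1 • p) (m t.1)] at h6
      rw [hd]
      simp only [hrad]
      rcases h6 with h6 | h6 <;> linarith
    · intro t ht w hw w' hw'
      have h1 := dist_le_suppDiam p hw hw'
      rw [mul_smul, mul_smul, dist_smul] at h1
      simp only [hrad]
      linarith
    · rintro ⟨j, g⟩ ht ⟨j', g'⟩ ht' hix hd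
      obtain rfl : j = j' := hix
      by_contra hne
      have hg : g'⁻¹ * g ≠ 1 := fun h1 => hne (by rw [inv_mul_eq_one.1 h1])
      have h1 := hG _ hg (m j)
      rw [← dist_smul g', smul_smul, mul_inv_cancel_left] at h1
      exact absurd hd (not_le.2 h1)
  obtain ⟨w₀, hw₀, htop⟩ : ∃ w₀ ∈ S t₁, dist (c t₁) p + rad t₁.1 - 2 * δ ≤ dist (w₀ • p) p := by
    obtain ⟨h1, h2, h3, h4, h5⟩ := hm t₁.1 (hTξ ht₁)
    -- One end of the diametral pair is almost as far from `p` as the center plus the radius.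
    have h6 := hX.four_point p (t₁.2 • y t₁.1 • p) (c t₁) (t₁.2 • z t₁.1 • p)
    simp only [hc, dist_smul, h3, h5] at h6
    rw [dist_comm (y t₁.1 • p), h4, dist_comm p, dist_comm p, dist_comm p] at h6
    simp only [hrad]
    rcases h6 with h6 | h6
    · refine ⟨t₁.2 * y t₁.1, by simpa [hS] using h1, ?_⟩
      rw [mul_smul]; simp only [hc]; linarith
    · refine ⟨t₁.2 * z t₁.1, by simpa [hS] using h2, ?_⟩
      rw [mul_smul]; simp only [hc]; linarith
  obtain ⟨T', hT'T, ⟨i, g⟩, ht₀, θ, huniq, hclosed, hsmall⟩ :=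
    hT.exists_subfamily hX hδ ht₁ hw₀ htop
  have hk : (a i).coeff g ≠ 0 := by simpa [hTdef] using hT'T ht₀
  set η : MonoidAlgebra K G := ∑ t ∈ T', single t.2 ((a t.1).coeff t.2) * ξ t.1 with hη
  have hηc (w : G) : η.coeff w = ∑ t ∈ T', (a t.1).coeff t.2 * (ξ t.1).coeff (t.2⁻¹ * w) := by
    simp [hη]
  have hzero (w : G) : ∑ t ∈ T, (a t.1).coeff t.2 * (ξ t.1).coeff (t.2⁻¹ * w) = 0 := by
    have h1 := congrArg (fun f : MonoidAlgebra K G => f.coeff w) h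
    simp only [MonoidAlgebra.coeff_sum, Finsupp.finsetSum_apply, coeff_mul_eq_sum] at h1
    rw [hTdef, Finset.sum_sigma]
    simpa using h1
  have hlow (w : G) (hw : η.coeff w ≠ 0) : dist (w • p) p < θ ∧ ∃ t ∈ T', w ∈ S t := by
    rw [hηc] at hw
    obtain ⟨t, ht, htw⟩ := Finset.exists_ne_zero_of_sum_ne_zero hw
    have hwt : w ∈ S t := right_ne_zero_of_mul htw
    refine ⟨?_, t, ht, hwt⟩
    by_contra! hle
    apply hw
    -- At a far point the members outside `T'` contribute nothing, so the partial sum is the full,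
    -- vanishing one.
    rw [← hzero w]
    refine Finset.sum_subset hT'T fun s hs hs' => ?_
    by_contra hne
    exact hs' (hclosed t ht w hwt hle s hs (right_ne_zero_of_mul hne))
  -- Normalising by `g` and its coefficient turns the only index-`i` term of `η` into `ξ i`, which
  -- allows `b i = 0`.
  set b : ι → MonoidAlgebra K G := fun j => if j = i then 0 else
    ∑ t ∈ T' with t.1 = j, single (g⁻¹ * t.2) (((a i).coeff g)⁻¹ * (a t.1).coeff t.2) with hb
  have hsum : ξ i + ∑ j, b j * ξ j = single g⁻¹ ((a i).coeff g)⁻¹ * η := by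
    have h1 : single g⁻¹ ((a i).coeff g)⁻¹ * η = ∑ t ∈ T',
        single (g⁻¹ * t.2) (((a i).coeff g)⁻¹ * (a t.1).coeff t.2) * ξ t.1 := by
      rw [hη, Finset.mul_sum]
      refine Finset.sum_congr rfl fun t _ => ?_
      rw [← mul_assoc, single_mul_single]
    rw [h1, ← Finset.sum_fiberwise T' Sigma.fst,
      ← Finset.add_sum_erase _ (fun j => b j * ξ j) (Finset.mem_univ i),
      ← Finset.add_sum_erase _ _ (Finset.mem_univ i)]
    have h2 : T'.filter (fun t => t.1 = i) = {⟨i, g⟩} := by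
      ext t
      simp only [Finset.mem_filter, Finset.mem_singleton]
      exact ⟨fun ht => huniq t ht.1 ht.2, by rintro rfl; exact ⟨ht₀, rfl⟩⟩
    rw [h2, Finset.sum_singleton]
    simp only [inv_mul_cancel, inv_mul_cancel₀ hk, ← one_def, one_mul]
    rw [show b i = 0 by simp [hb], zero_mul, zero_add]
    congr 1
    refine Finset.sum_congr rfl fun j hj => ?_
    rw [hb]
    simp only [Finset.ne_of_mem_erase hj, if_false]
    rw [Finset.sum_mul]
    refine Finset.sum_congr rfl fun t ht => ?_
    rw [(Finset.mem_filter.1 ht).2]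
  refine ⟨i, b, hTξ (hT'T ht₀), by simp [hb], ?_, ?_⟩
  · intro j hj
    simp only [hb]
    split_ifs
    · rfl
    · refine Finset.sum_eq_zero fun t ht => ?_
      rw [(Finset.mem_filter.1 ht).2, hξa j hj]
      simp
  · rw [hsum]
    by_cases h0 : single g⁻¹ ((a i).coeff g)⁻¹ * η = 0
    · exact Or.inl h0
    right
    have hbound (u v : G) (hu : (single g⁻¹ ((a i).coeff g)⁻¹ * η).coeff u ≠ 0)
        (hv : (single g⁻¹ ((a i).coeff g)⁻¹ * η).coeff v ≠ 0) :
        dist (u • p) (v • p) ≤ suppDiam p (ξ i) - δ := by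
      rw [coeff_single_mul_apply, inv_inv] at hu hv
      obtain ⟨h1, t, ht, hut⟩ := hlow _ (right_ne_zero_of_mul hu)
      obtain ⟨h2, s, hs, hvs⟩ := hlow _ (right_ne_zero_of_mul hv)
      have := hsmall t ht s hs _ hut _ hvs h1 h2
      rw [mul_smul, mul_smul, dist_smul] at this
      simp only [hrad] at this
      linarith
    obtain ⟨u, -, hu, -⟩ := exists_dist_eq_suppDiam p h0
    exact suppDiam_le (dist_nonneg.trans (hbound u u hu hu)) hbound

end SuppDiam

/-! ### Elementary reduction of vectors and matrices. -/

section Elementary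

open Matrix

variable {n : ℕ} {R : Type*} [Ring R]

/-- The elementary matrix `1 + single i j c` as an element of `GL n R`. -/
def elemGL {i j : Fin n} (h : i ≠ j) (c : R) : GeneralLinearGroup (Fin n) R where
  val := 1 + single i j c
  inv := 1 - single i j c
  val_inv := by
    rw [add_mul, mul_sub, mul_sub, single_mul_single_of_ne _ _ _ _ h.symm]; simp
  inv_val := by
    rw [sub_mul, mul_add, mul_add, single_mul_single_of_ne _ _ _ _ h.symm]; simp

theorem elemGL_mem_GE {i j : Fin n} (h : i ≠ j) (c : R) : elemGL h c ∈ GE n R :=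
  Subgroup.subset_closure (Or.inl ⟨i, j, c, h, rfl⟩)

theorem exists_row_operation (i : Fin n) (b : Fin n → R) (s : Finset (Fin n)) (hs : i ∉ s) :
    ∃ U ∈ GE n R, (U : Matrix (Fin n) (Fin n) R) = 1 + ∑ j ∈ s, single i j (b j) := by
  induction s using Finset.induction_on with
  | empty => exact ⟨1, one_mem _, by simp⟩
  | insert k s hk ih =>
    obtain ⟨hik, his⟩ := not_or.1 (Finset.mem_insert.not.1 hs)
    obtain ⟨U, hU, hU'⟩ := ih his
    refine ⟨U * elemGL hik (b k), mul_mem hU (elemGL_mem_GE _ _), ?_⟩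
    have : (∑ j ∈ s, single i j (b j)) * single i k (b k) = 0 := by
      rw [Finset.sum_mul]
      refine Finset.sum_eq_zero fun j hj => ?_
      exact single_mul_single_of_ne _ _ _ _ (by rintro rfl; exact his hj) _
    rw [Units.val_mul, hU', elemGL, Finset.sum_insert hk, mul_add, mul_one, add_mul, this]
    simp only [one_mul, add_zero]
    abel

theorem exists_col_operation (k : Fin n) (b : Fin n → R) (s : Finset (Fin n)) (hs : k ∉ s) :
    ∃ U ∈ GE n R, (U : Matrix (Fin n) (Fin n) R) = 1 + ∑ i ∈ s, single i k (b i) := by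
  induction s using Finset.induction_on with
  | empty => exact ⟨1, one_mem _, by simp⟩
  | insert i s hi ih =>
    obtain ⟨hki, hks⟩ := not_or.1 (Finset.mem_insert.not.1 hs)
    obtain ⟨U, hU, hU'⟩ := ih hks
    refine ⟨elemGL (Ne.symm hki) (b i) * U, mul_mem (elemGL_mem_GE _ _) hU, ?_⟩
    have : single i k (b i) * (∑ j ∈ s, single j k (b j)) = 0 := by
      rw [Finset.mul_sum]
      refine Finset.sum_eq_zero fun j hj => ?_
      exact single_mul_single_of_ne _ _ _ _ (by rintro rfl; exact hks hj) _
    rw [Units.val_mul, hU', elemGL, Finset.sum_insert hi, add_mul, one_mul, mul_add, this, mul_one]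
    simp only [add_zero]
    abel

/-- The `j`-th column of `A` is the `j`-th standard basis vector. -/
def HasStdCol (A : Matrix (Fin n) (Fin n) R) (j : Fin n) : Prop :=
  ∀ i, A i j = (1 : Matrix (Fin n) (Fin n) R) i j

theorem HasStdCol.mul_apply {B : Matrix (Fin n) (Fin n) R} {j : Fin n} (hB : HasStdCol B j)
    (A : Matrix (Fin n) (Fin n) R) (i : Fin n) : (A * B) i j = A i j := by
  rw [Matrix.mul_apply]
  simp_rw [hB _]
  rw [← Matrix.mul_apply, mul_one]

theorem HasStdCol.mul {A B : Matrix (Fin n) (Fin n) R} {j : Fin n} (hA : HasStdCol A j)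
    (hB : HasStdCol B j) : HasStdCol (A * B) j := fun i => by
  rw [hB.mul_apply, hA i]

/-- The non-zero entries of `w` are left linearly independent. -/
def NonzeroIndep (w : Fin n → R) : Prop :=
  ∀ a : Fin n → R, (∀ j, w j = 0 → a j = 0) → ∑ j, a j * w j = 0 → a = 0

/-- If a dependency always allows one to shorten some entry by at least `δ`, then each vector can be
brought by elementary operations to one with independent non-zero entries. -/
theorem exists_nonzeroIndep {D : R → ℝ} (hD : ∀ x, 0 ≤ D x) {δ : ℝ} (hδ : 0 < δ)
    (hred : ∀ ξ : Fin n → R, ¬ NonzeroIndep ξ → ∃ i, ∃ b : Fin n → R, ξ i ≠ 0 ∧ b i = 0 ∧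
      (∀ j, ξ j = 0 → b j = 0) ∧ D (ξ i + ∑ j, b j * ξ j) ≤ D (ξ i) - δ) (v : Fin n → R) :
    ∃ B ∈ GE n R, (∀ j, v j = 0 → HasStdCol (B : Matrix (Fin n) (Fin n) R) j) ∧
      (∀ j, v j = 0 → ((B : Matrix (Fin n) (Fin n) R) *ᵥ v) j = 0) ∧
      NonzeroIndep ((B : Matrix (Fin n) (Fin n) R) *ᵥ v) := by
  obtain ⟨N, hN⟩ := exists_nat_gt ((∑ j, D (v j)) / δ)
  rw [div_lt_iff₀ hδ] at hN
  induction N generalizing v with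
  | zero =>
    have := Finset.sum_nonneg fun j (_ : j ∈ Finset.univ) => hD (v j)
    simp at hN
    linarith
  | succ N ih =>
    by_cases hv : NonzeroIndep v
    · exact ⟨1, one_mem _, fun j _ i => rfl, fun j hj => by simpa using hj, by simpa using hv⟩
    · obtain ⟨i, b, hi, hbi, hb, hDb⟩ := hred v hv
      obtain ⟨U, hU, hU'⟩ := exists_row_operation i b (Finset.univ.erase i) (by simp)
      have hUv : (U : Matrix (Fin n) (Fin n) R) *ᵥ v =
          Function.update v i (v i + ∑ j, b j * v j) := by
        rw [hU', add_mulVec, one_mulVec, sum_mulVec]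
        ext r
        simp only [single_mulVec, Pi.add_apply, Finset.sum_apply]
        rcases eq_or_ne r i with rfl | hr
        · rw [← Finset.add_sum_erase _ (fun j => b j * v j) (Finset.mem_univ r)]
          simp [hbi]
        · simp [hr]
      have hz (j) (hj : v j = 0) : ((U : Matrix (Fin n) (Fin n) R) *ᵥ v) j = 0 := by
        have : j ≠ i := by rintro rfl; exact hi hj
        rw [hUv, Function.update_of_ne this, hj]
      have hUcol (j) (hj : v j = 0) : HasStdCol (U : Matrix (Fin n) (Fin n) R) j := by
        intro r
        rw [hU', Matrix.add_apply, Matrix.sum_apply, Finset.sum_eq_zero, add_zero]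
        intro k _
        rw [Matrix.single_apply]
        split_ifs with h
        · rw [h.2, hb j hj]
        · rfl
      obtain ⟨B, hB, h1, h2, h3⟩ := ih (U *ᵥ v) (by
        have h4 : ∑ j, D ((U.1 *ᵥ v) j) ≤ ∑ j, D (v j) - δ := by
          rw [hUv, ← Finset.add_sum_erase _ _ (Finset.mem_univ i),
            ← Finset.add_sum_erase _ (fun j => D (v j)) (Finset.mem_univ i),
            Function.update_self]
          have : ∑ x ∈ Finset.univ.erase i, D (Function.update v i (v i + ∑ j, b j * v j) x) =
              ∑ x ∈ Finset.univ.erase i, D (v x) :=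
            Finset.sum_congr rfl fun x hx => by
              rw [Function.update_of_ne (Finset.ne_of_mem_erase hx)]
          rw [this]
          linarith
        push_cast at hN
        linarith)
      refine ⟨B * U, mul_mem hB hU, ?_, ?_, ?_⟩
      · intro j hj
        rw [Units.val_mul]
        exact (h1 j (hz j hj)).mul (hUcol j hj)
      · intro j hj
        rw [Units.val_mul, ← mulVec_mulVec]
        exact h2 j (hz j hj)
      · rw [Units.val_mul, ← mulVec_mulVec]
        exact h3

/-- A unimodular vector with independent non-zero entries has a single non-zero entry, a unit. -/
theorem NonzeroIndep.exists_unit {F : Type*} [Field F] (ε : R →+* F) {w c : Fin n → R}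
    (hw : NonzeroIndep w) (hc : ∑ j, c j * w j = 1) :
    ∃ i u, u * w i = 1 ∧ w i * u = 1 ∧ ∀ j, j ≠ i → w j = 0 := by
  classical
  have : Nontrivial R := ε.domain_nontrivial
  set b : Fin n → R := fun j => if w j = 0 then 0 else c j with hb
  have hbw : ∑ j, b j * w j = 1 := by
    rw [← hc]
    refine Finset.sum_congr rfl fun j _ => ?_
    by_cases h : w j = 0 <;> simp [hb, h]
  -- Left multiplication of `∑ b j * w j = 1` by `w i` gives a dependency, hence the coefficients
  -- agree.
  have hδ (i j) (hi : w i ≠ 0) : w i * b j = if i = j then 1 else 0 := by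
    have h := hw (fun j => w i * b j - if i = j then 1 else 0) ?_ ?_
    · exact sub_eq_zero.1 (congrFun h j)
    · intro k hk
      have : i ≠ k := by rintro rfl; exact hi hk
      simp [hb, hk, this]
    · simp [sub_mul, mul_assoc, ← Finset.mul_sum, hbw]
  obtain ⟨i, -, hi⟩ := Finset.exists_ne_zero_of_sum_ne_zero (hbw.trans_ne one_ne_zero)
  have hi := right_ne_zero_of_mul hi
  have hothers : ∀ j, j ≠ i → w j = 0 := by
    intro j hj
    by_contra hwj
    have h1 := congrArg ε (hδ i i hi)
    have h2 := congrArg ε (hδ j j hwj)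
    have h3 := congrArg ε (hδ i j hi)
    simp only [if_true, if_neg hj.symm, map_mul, map_one, map_zero] at h1 h2 h3
    rcases mul_eq_zero.1 h3 with h | h
    · rw [h, zero_mul] at h1; exact zero_ne_one h1
    · rw [h, mul_zero] at h2; exact zero_ne_one h2
  refine ⟨i, b i, ?_, by simpa using hδ i i hi, hothers⟩
  rw [← hbw, Finset.sum_eq_single i]
  · intro j _ hj
    rw [hothers j hj, mul_zero]
  · simp

/-- Column `k` is truncated to the rows in `insert k S`. The reducing matrix `B` has standard
columns where the truncation vanishes, so finished columns survive. -/
theorem mem_GE_of_hasStdCol {F : Type*} [Field F] (ε : R →+* F)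
    (hnf : ∀ v : Fin n → R,
      ∃ B ∈ GE n R, (∀ j, v j = 0 → HasStdCol (B : Matrix (Fin n) (Fin n) R) j) ∧
      (∀ j, v j = 0 → ((B : Matrix (Fin n) (Fin n) R) *ᵥ v) j = 0) ∧
      NonzeroIndep ((B : Matrix (Fin n) (Fin n) R) *ᵥ v)) (S : Finset (Fin n)) :
    ∀ A : GeneralLinearGroup (Fin n) R,
      (∀ j, j ∉ S → HasStdCol (A : Matrix (Fin n) (Fin n) R) j) → A ∈ GE n R := by
  induction S using Finset.induction_on with
  | empty =>
    intro A hA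
    have : A = 1 := Units.ext (Matrix.ext fun i j => hA j (by simp) i)
    rw [this]
    exact one_mem _
  | insert k S hk ih =>
    intro A hA
    set v : Fin n → R := fun i => if i ∈ insert k S then A.1 i k else 0 with hv
    have hv0 (l) (hl : l ∉ insert k S) : v l = 0 := by simp only [hv, if_neg hl]
    -- Row `k` of `A⁻¹` vanishes outside `insert k S`, so truncation preserves unimodularity.
    have hAv : ∑ i, A⁻¹.1 k i * v i = 1 := by
      have h1 : (A⁻¹.1 * A.1) k k = 1 := by
        rw [← Units.val_mul, inv_mul_cancel]; simp
      rw [← h1, Matrix.mul_apply]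
      refine Finset.sum_congr rfl fun i _ => ?_
      by_cases hi : i ∈ insert k S
      · simp only [hv, if_pos hi]
      · have hki : k ≠ i := by rintro rfl; simp at hi
        have : A⁻¹.1 k i = 0 := by
          rw [← (hA i hi).mul_apply A⁻¹.1 k, ← Units.val_mul, inv_mul_cancel]
          simp [hki]
        rw [this, zero_mul, zero_mul]
    obtain ⟨B, hB, hB1, hB2, hB3⟩ := hnf v
    obtain ⟨i₀, u, hu, hu', hothers⟩ := hB3.exists_unit ε (c := A⁻¹.1 k ᵥ* B⁻¹.1) (by
      have : (A⁻¹.1 k ᵥ* B⁻¹.1) ⬝ᵥ (B.1 *ᵥ v) = A⁻¹.1 k ⬝ᵥ v := by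
        rw [dotProduct_mulVec, vecMul_vecMul, ← Units.val_mul, inv_mul_cancel, Units.val_one,
          vecMul_one]
      exact this.trans hAv)
    have : Nontrivial R := ε.domain_nontrivial
    have hi₀ : i₀ ∈ insert k S := by
      by_contra h
      rw [hB2 i₀ (hv0 i₀ h), mul_zero] at hu
      exact zero_ne_one hu
    have hBA (i) (hi : i ∈ insert k S) : (B.1 * A.1) i k = (B.1 *ᵥ v) i := by
      rw [Matrix.mul_apply, mulVec, dotProduct]
      refine Finset.sum_congr rfl fun l _ => ?_
      by_cases hl : l ∈ insert k S
      · simp only [hv, if_pos hl]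
      · have : i ≠ l := by rintro rfl; exact hl hi
        rw [hB1 l (hv0 l hl) i, Matrix.one_apply_ne this, zero_mul, zero_mul]
    -- If the unit is in row `k`, scale it to `1`; otherwise add `u` times row `i₀` to row `k`,
    -- whose entry is `0`.
    obtain ⟨C, hC, hC1, hC2⟩ : ∃ C ∈ GE n R, (∀ j, j ∉ insert k S → HasStdCol C.1 j) ∧
        (C.1 * (B.1 * A.1)) k k = 1 := by
      rcases eq_or_ne i₀ k with rfl | hik
      · refine ⟨⟨diagonal (Function.update 1 i₀ u),
          diagonal (Function.update 1 i₀ ((B.1 *ᵥ v) i₀)), ?_, ?_⟩,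
          Subgroup.subset_closure (Or.inr ⟨_, rfl⟩), ?_, ?_⟩
        · rw [diagonal_mul_diagonal, ← diagonal_one]
          congr 1
          ext j
          rcases eq_or_ne j i₀ with rfl | hj
          · simp [hu]
          · simp [hj]
        · rw [diagonal_mul_diagonal, ← diagonal_one]
          congr 1
          ext j
          rcases eq_or_ne j i₀ with rfl | hj
          · simp [hu']
          · simp [hj]
        · intro j hj i
          have : j ≠ i₀ := by rintro rfl; simp at hj
          rcases eq_or_ne i j with rfl | hij
          · simp [this]
          · simp [hij]
        · simp only
          rw [diagonal_mul, hBA i₀ hi₀, Function.update_self, hu]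
      · refine ⟨elemGL hik.symm u, elemGL_mem_GE _ _, ?_, ?_⟩
        · intro j hj i
          have : i₀ ≠ j := by rintro rfl; exact hj hi₀
          simp [elemGL, this]
        · simp only [elemGL]
          rw [add_mul, one_mul, Matrix.add_apply, single_mul_apply_same, hBA i₀ hi₀,
            hBA k (by simp), hothers k hik.symm, hu, zero_add]
    set A₂ : GeneralLinearGroup (Fin n) R := C * (B * A) with hA₂
    have hA₂k : A₂.1 k k = 1 := hC2
    have hA₂S (j) (hj : j ∉ insert k S) : HasStdCol A₂.1 j :=
      (hC1 j hj).mul ((hB1 j (hv0 j hj)).mul (hA j hj))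
    obtain ⟨U, hU, hU'⟩ := exists_col_operation k (fun i => -A₂.1 i k) (Finset.univ.erase k)
      (by simp)
    have hmem : U * A₂ ∈ GE n R := by
      apply ih
      intro j hj
      rw [Units.val_mul, hU']
      rcases eq_or_ne j k with rfl | hjk
      · intro i
        rw [add_mul, one_mul, Finset.sum_mul, Matrix.add_apply, Matrix.sum_apply]
        rcases eq_or_ne i j with rfl | hij
        · rw [Finset.sum_eq_zero]
          · simp [hA₂k]
          · intro l hl
            rw [single_mul_apply_of_ne _ _ _ _ _ (Finset.ne_of_mem_erase hl).symm]
        · rw [Finset.sum_eq_single i]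
          · simp [hA₂k, hij]
          · intro l _ hl
            rw [single_mul_apply_of_ne _ _ _ _ _ hl.symm]
          · simp [hij]
      · have hj' : j ∉ insert k S := by simp [hjk, hj]
        refine HasStdCol.mul (fun i => ?_) (hA₂S j hj')
        rw [Matrix.add_apply, Matrix.sum_apply, Finset.sum_eq_zero, add_zero]
        intro l _
        simp [hjk.symm]
    rwa [Subgroup.mul_mem_cancel_left _ hU, hA₂, Subgroup.mul_mem_cancel_left _ hC,
      Subgroup.mul_mem_cancel_left _ hB] at hmem

theorem free_span_of_nonzeroIndep {ξ : Fin n → R} {B : GeneralLinearGroup (Fin n) R}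
    (h : NonzeroIndep ((B : Matrix (Fin n) (Fin n) R) *ᵥ ξ)) :
    Module.Free R (Ideal.span (Set.range ξ) : Ideal R) := by
  have hle (A : Matrix (Fin n) (Fin n) R) (w : Fin n → R) :
      Ideal.span (Set.range (A *ᵥ w)) ≤ Ideal.span (Set.range w) := by
    rw [Ideal.span_le]
    rintro _ ⟨i, rfl⟩
    change ∑ j, A i j * w j ∈ Ideal.span (Set.range w)
    exact sum_mem fun j _ => Ideal.mul_mem_left _ (A i j) (Ideal.subset_span ⟨j, rfl⟩)
  set w := (B : Matrix (Fin n) (Fin n) R) *ᵥ ξ with hw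
  have hspan : Ideal.span (Set.range ξ) = Submodule.span R (w '' {j | w j ≠ 0}) := by
    apply le_antisymm
    · have hξ : ξ = B⁻¹.1 *ᵥ w := by
        rw [hw, mulVec_mulVec, ← Units.val_mul, inv_mul_cancel, Units.val_one, one_mulVec]
      rw [hξ]
      refine (hle _ _).trans (Ideal.span_le.2 ?_)
      rintro _ ⟨j, rfl⟩
      by_cases hj : w j = 0
      · rw [hj]; exact Submodule.zero_mem _
      · exact Submodule.subset_span ⟨j, hj, rfl⟩
    · exact (Submodule.span_mono (Set.image_subset_range _ _)).trans (hle _ _)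
  have hli : LinearIndepOn R w {j | w j ≠ 0} := by
    rw [linearIndepOn_iff]
    intro l hl h0
    rw [Finsupp.linearCombination_apply,
      Finsupp.sum_fintype l (fun i a => a • w i) fun i => zero_smul R (w i)] at h0
    refine DFunLike.coe_injective (h l (fun j hj => ?_) h0)
    by_contra hne
    exact hl (Finsupp.mem_support_iff.2 hne) hj
  rw [hspan, Set.image_eq_range]
  exact Module.Free.of_basis (Module.Basis.span hli)

end Elementary

end HypGroup

end

/-! ### The main theorem. -/

theorem theorem1p4 {K G X : Type*} [Field K] [Group G] [MetricSpace X] [Nonempty X]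
    [MulAction G X] [IsIsometricSMul G X] (n : ℕ) (δ : ℝ)
    (hX : HypGroup.IsHyperbolicSpace X δ)
    (hG : ENNReal.ofReal ((2 * (n : ℝ) + 11) ^ 2 * δ) < HypGroup.minDisplacement G X) :
    (∀ ξ : Fin n → MonoidAlgebra K G,
      Module.Free (MonoidAlgebra K G)
        (Ideal.span (Set.range ξ) : Ideal (MonoidAlgebra K G))) ∧
    HypGroup.GE n (MonoidAlgebra K G) = ⊤ := by
  classical
  have hδ := hX.nonneg
  -- The strict inequality leaves room for some `δ' > δ`, positive even if `δ = 0`, so each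
  -- reduction gains a fixed amount.
  obtain ⟨C, hC, hCG⟩ := ENNReal.lt_iff_exists_nnreal_btwn.1 hG
  have hpos : 0 < (2 * (n : ℝ) + 11) ^ 2 := by positivity
  set δ' : ℝ := C / (2 * (n : ℝ) + 11) ^ 2 with hδ'
  have hCδ : (2 * (n : ℝ) + 11) ^ 2 * δ' = C := by
    rw [hδ']; field_simp
  have hlt : δ < δ' := by
    rw [hδ', lt_div_iff₀ hpos, mul_comm]
    rw [ENNReal.ofReal_lt_coe_iff (by positivity)] at hC
    exact hC
  have hdisp (g : G) (hg : g ≠ 1) (q : X) :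
      (2 * (Fintype.card (Fin n) : ℝ) + 11) ^ 2 * δ' < dist (g • q) q := by
    rw [Fintype.card_fin, hCδ]
    have h1 : HypGroup.minDisplacement G X ≤ edist (g • q) q :=
      (iInf₂_le g hg).trans (iInf_le _ q)
    have h2 := hCG.trans_le h1
    rw [edist_nndist] at h2
    exact_mod_cast h2
  obtain ⟨p⟩ := ‹Nonempty X›
  have hδ'0 : 0 < δ' := hδ.trans_lt hlt
  have hnf := HypGroup.exists_nonzeroIndep (n := n) (R := MonoidAlgebra K G)
    -- The shift by `δ'` makes an entry that becomes zero also count as a gain of at least `δ'`.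
    (D := fun x => if x = 0 then 0 else HypGroup.suppDiam p x + δ')
    (fun x => by
      have := HypGroup.suppDiam_nonneg p x
      split_ifs <;> linarith) hδ'0 (by
      intro ξ hξ
      unfold HypGroup.NonzeroIndep at hξ
      push Not at hξ
      obtain ⟨a, ha, hsum, hne⟩ := hξ
      obtain ⟨i, b, hi, hbi, hb, h⟩ := HypGroup.exists_suppDiam_add_le (hX.mono hlt.le) hδ'0.le
        hdisp p hne ha hsum
      refine ⟨i, b, hi, hbi, hb, ?_⟩
      have := HypGroup.suppDiam_nonneg p (ξ i)
      rw [if_neg hi]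
      split_ifs with h0
      · linarith
      · have := h.resolve_left h0
        linarith)
  refine ⟨fun ξ => ?_, ?_⟩
  · obtain ⟨B, -, -, -, h⟩ := hnf ξ
    exact HypGroup.free_span_of_nonzeroIndep h
  · rw [eq_top_iff]
    intro A _
    exact HypGroup.mem_GE_of_hasStdCol
      (MonoidAlgebra.lift K K G (1 : G →* K)).toRingHom hnf Finset.univ A (by simp)
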